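/- For small categories $\mathbb A,\mathbb B$, a profunctor $T:\mathbb A\nrightarrow\mathbb B$ is a functor $\mathbb A^{\mathrm{op}}\times\mathbb B\to\mathbf{Set}$; profunctors compose by $(TS)(a,c)=\int^{b}S(a,b)\times T(b,c)$, with tensor product $(S\times T)\big((a,c),(b,d)\big)=S(a,b)\times T(c,d)$ and identities $I_{\mathbb A}(a,a')=\mathbb A(a,a')$. Write $\mathbf 1$ and $\mathbf 0$ for the terminal and the empty category, and identify presheaves $V\in\mathbf{Set}^{\mathbb A}$ with profunctors $V:\mathbf 1\nrightarrow\mathbb A$. The combinatorial Fock space $!\mathbb A$ is the category of finite tuples of objects of $\mathbb A$, with $!\mathbb A\big((x_1,\dots,x_m),(y_1,\dots,y_n)\big)=\coprod_{\sigma\in S_n}\prod_{i}\mathbb A(x_i,y_{\sigma i})$ if $m=n$ and $\emptyset$ otherwise. Write $()$ for the empty tuple, $\cdot$ for concatenation and $(\alpha_1,\dots,\alpha_n)^\flat=\alpha_1\cdot\ldots\cdot\alpha_n$ for flattening. For $T:\mathbb A\nrightarrow\mathbb B$ let $$(!T)(x,y)=\int^{z\in\,!(\mathbb A^{\mathrm{op}}\times\mathbb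 B)}\Big(\prod_i T(z_i)\Big)\times{!\mathbb A}(x,!\pi_1 z)\times{!\mathbb B}(!\pi_2 z,y).$$ Define: * the vacuum $\mathrm{vac}_{\mathbb A}:\mathbf 1\nrightarrow{!\mathbb A}$, $\mathrm{vac}_{\mathbb A}(*,x)={!\mathbb A}\big((),x\big)$; * $\delta_{\mathbb A}:{!\mathbb A}\nrightarrow{!!\mathbb A}$, $\delta_{\mathbb A}(x,\alpha)={!\mathbb A}(x,\alpha^\flat)$, and $\mu_{\mathbb A}:{!!\mathbb A}\nrightarrow{!\mathbb A}$, $\mu_{\mathbb A}(\alpha,x)={!\mathbb A}(\alpha^\flat,x)$; * the creation operator $\eta^\dagger_{\mathbb A}:\mathbb A\times{!\mathbb A}\nrightarrow{!\mathbb A}$, $\eta^\dagger_{\mathbb A}\big((a,x),y\big)={!\mathbb A}(x\cdot(a),y)$, and, for $V:\mathbf 1\nrightarrow\mathbb A$, the operator $\eta^{\dagger,V}_{\mathbb A}=\big({!\mathbb A}\cong\mathbf 1\times{!\mathbb A}\xrightarrow{V\times I}\mathbb A\times{!\mathbb A}\xrightarrow{\eta^\dagger_{\mathbb A}}{!\mathbb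 A}\big)$; * for $M:{!\mathbb B}\nrightarrow\mathbb B$ the structure map of a pseudo $!$-algebra and $T:{!\mathbb X}\nrightarrow\mathbb B$, the exponential $\exp_M(T)=M\circ{!T}\circ\delta_{\mathbb X}:{!\mathbb X}\nrightarrow\mathbb B$ (used here for the free algebra $M=\mu_{\mathbb A}$); * for $V:\mathbf 1\nrightarrow\mathbb A$, the coherent state extension $\mathrm{ext}\,V=\big(\mathbf 1\cong{!\mathbf 0}\xrightarrow{\delta_{\mathbf 0}}{!!\mathbf 0}\cong{!\mathbf 1}\xrightarrow{!V}{!\mathbb A}\big)$, where $\mathbf 1\cong{!\mathbf 0}$ is the canonical equivalence. **Theorem.** For every small category $\mathbb A$ and every $V\in\mathbf{Set}^{\mathbb A}$, $$\exp_{\mu_{\mathbb A}}\big(\eta^{\dagger,V}_{\mathbb A}\big)\circ\mathrm{vac}_{\mathbb A}\;\cong\;\mathrm{ext}\,V$$ naturally as profunctors $\mathbf 1\nrightarrow{!\mathbb A}$, and $$\mathrm{ext}\,V\;\cong\;\int^{\vec a\in{!\mathbb A}}\Big(\prod_i V_{a_i}\Big)\cdot|\vec a\rangle$$ in $\mathbf{Set}^{!\mathbb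 A}$, where $|\vec a\rangle={!\mathbb A}(\vec a,-)$ and $S\cdot|\vec a\rangle=S\times{!\mathbb A}(\vec a,-)$. -/

import Mathlib

open CategoryTheory Opposite

universe u

namespace FockSpace

/-! ### The combinatorial Fock space of a small category -/

/-- Objects of the combinatorial Fock space `!A`: finite tuples of objects of `A`. -/
structure Fock (A : Type u) : Type u where
  len : ℕ
  get : Fin len → A

namespace Fock

section Cat

variable {A : Type u} [SmallCategory A]

/-- A morphism of tuples `x ⟶ y` is a bijection `σ` of the index sets (so there is none unless the
lengths agree) together with morphisms `x i ⟶ y (σ i)` in `A`. -/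
structure Hom (x y : Fock A) : Type u where
  perm : Fin x.len ≃ Fin y.len
  app : ∀ i, x.get i ⟶ y.get (perm i)

instance : SmallCategory (Fock A) where
  Hom x y := Hom x y
  id x := ⟨Equiv.refl _, fun i => 𝟙 (x.get i)⟩
  comp f g := ⟨f.perm.trans g.perm, fun i => f.app i ≫ g.app (f.perm i)⟩
  id_comp f := by
    cases f
    simp
    rfl
  comp_id f := by
    cases f
    simp
    rfl
  assoc f g h := congrArg (Hom.mk ((f.perm.trans g.perm).trans h.perm))
    (funext fun i => Category.assoc (f.app i) (g.app (f.perm i)) (h.app (g.perm (f.perm i))))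

theorem hom_ext {x y : Fock A} {f g : x ⟶ y} (h : ∀ i, f.perm i = g.perm i)
    (h' : ∀ i, f.app i ≫ eqToHom (congrArg y.get (h i)) = g.app i) : f = g := by
  obtain ⟨σ, a⟩ := f
  obtain ⟨τ, b⟩ := g
  obtain rfl : σ = τ := Equiv.ext h
  congr 1
  funext i
  simpa using h' i

@[simp] theorem id_perm (x : Fock A) : (𝟙 x : x ⟶ x).perm = Equiv.refl _ := rfl

@[simp] theorem id_app (x : Fock A) (i : Fin x.len) : (𝟙 x : x ⟶ x).app i = 𝟙 (x.get i) := rfl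

@[simp] theorem comp_perm {x y z : Fock A} (f : x ⟶ y) (g : y ⟶ z) :
    (f ≫ g).perm = f.perm.trans g.perm := rfl

@[simp] theorem comp_app {x y z : Fock A} (f : x ⟶ y) (g : y ⟶ z) (i : Fin x.len) :
    (f ≫ g).app i = f.app i ≫ g.app (f.perm i) := rfl

theorem eqToHom_app {x y : Fock A} (f : x ⟶ y) {i j : Fin x.len} (h : i = j) :
    eqToHom (congrArg x.get h) ≫ f.app j =
      f.app i ≫ eqToHom (congrArg (fun k => y.get (f.perm k)) h) := by
  subst h
  simp

/-- The component of a morphism of tuples that lands in the entry `j` of its target. -/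
def Hom.appTo {x y : Fock A} (f : x ⟶ y) (j : Fin y.len) :
    x.get (f.perm.symm j) ⟶ y.get j :=
  f.app (f.perm.symm j) ≫ eqToHom (congrArg y.get (f.perm.apply_symm_apply j))

theorem appTo_id (x : Fock A) (j : Fin x.len) : Hom.appTo (𝟙 x) j = 𝟙 (x.get j) := by
  simp [Hom.appTo]

theorem appTo_comp {x y z : Fock A} (f : x ⟶ y) (g : y ⟶ z) (k : Fin z.len) :
    Hom.appTo (f ≫ g) k = Hom.appTo f (g.perm.symm k) ≫ Hom.appTo g k := by
  have h := eqToHom_app g (f.perm.apply_symm_apply (g.perm.symm k))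
  simp only [Hom.appTo, Category.assoc]
  rw [reassoc_of% h]
  simp

/-- The tuple obtained from a finite family by an enumeration of its index set. -/
abbrev ofFam {I : Type} {n : ℕ} (e : I ≃ Fin n) (a : I → A) : Fock A := ⟨n, fun k => a (e.symm k)⟩

/-- The morphism of tuples given by a bijection of the index sets of two families and morphisms
between corresponding members. -/
def ofFamHom {I J : Type} {m n : ℕ} (e : I ≃ Fin m) (e' : J ≃ Fin n) {a : I → A} {b : J → A}
    (τ : I ≃ J) (φ : ∀ i, a i ⟶ b (τ i)) : ofFam e a ⟶ ofFam e' b where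
  perm := e.symm.trans (τ.trans e')
  app k := φ (e.symm k) ≫ eqToHom (congrArg b (e'.symm_apply_apply (τ (e.symm k))).symm)

theorem ofFamHom_id {I : Type} {m : ℕ} (e : I ≃ Fin m) (a : I → A) :
    ofFamHom e e (Equiv.refl I) (fun i => 𝟙 (a i)) = 𝟙 (ofFam e a) :=
  hom_ext (fun i => by simp [ofFamHom]) (fun i => by
    refine (congrArg (· ≫ eqToHom _) (Category.id_comp _)).trans ?_
    exact (eqToHom_trans _ _).trans (eqToHom_refl _ _))

theorem ofFamHom_comp {I J K : Type} {l m n : ℕ} (e : I ≃ Fin l) (e' : J ≃ Fin m)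
    (e'' : K ≃ Fin n) {a : I → A} {b : J → A} {c : K → A} (τ : I ≃ J) (φ : ∀ i, a i ⟶ b (τ i))
    (τ' : J ≃ K) (ψ : ∀ j, b j ⟶ c (τ' j)) (ρ : I ≃ K) (χ : ∀ i, a i ⟶ c (ρ i))
    (hρ : ∀ i, ρ i = τ' (τ i))
    (hχ : ∀ i, χ i ≫ eqToHom (congrArg c (hρ i)) = φ i ≫ ψ (τ i)) :
    ofFamHom e e'' ρ χ = ofFamHom e e' τ φ ≫ ofFamHom e' e'' τ' ψ := by
  have key : ∀ {j j' : J} (h : j = j') {w : A} (p : w ⟶ b j) {k k' k'' : K} (x : w ⟶ c k'')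
      (h₀ : k'' = τ' j) (h₁ : k'' = k') (h₂ : τ' j' = k) (h₃ : k = k'),
      x ≫ eqToHom (congrArg c h₀) = p ≫ ψ j →
      x ≫ eqToHom (congrArg c h₁) =
        (p ≫ eqToHom (congrArg b h)) ≫ ψ j' ≫ eqToHom (congrArg c (h₂.trans h₃)) := by
    intro j j' h w p k k' k'' x h₀ h₁ h₂ h₃ hx
    subst h h₁ h₂ h₃
    simpa using hx
  refine hom_ext (fun i => by simp [ofFamHom, hρ]) (fun i => ?_)
  refine ((Category.assoc _ _ _).trans (congrArg (_ ≫ ·) (eqToHom_trans _ _))).trans ?_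
  exact key (e'.symm_apply_apply (τ (e.symm i))).symm (φ (e.symm i)) (χ (e.symm i)) (hρ _)
    (by simp [ofFamHom, hρ]) rfl (by simp [ofFamHom]) (hχ _)

/-- The empty tuple. -/
def nil : Fock A := ⟨0, Fin.elim0⟩

/-- The functor `a ↦ (a)` forming one-entry tuples. -/
def single : A ⥤ Fock A where
  obj a := ⟨1, fun _ => a⟩
  map f := ⟨Equiv.refl _, fun _ => f⟩
  map_id _ := rfl
  map_comp _ _ := rfl

/-- Concatenation of tuples, `(x, y) ↦ x · y`. -/
def concat : Fock A × Fock A ⥤ Fock A where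
  obj p := ofFam finSumFinEquiv (Sum.elim p.1.get p.2.get)
  map {p q} f := ofFamHom finSumFinEquiv finSumFinEquiv (Equiv.sumCongr f.1.perm f.2.perm)
    (fun i => match i with
      | Sum.inl i => f.1.app i
      | Sum.inr i => f.2.app i)
  map_id p := by
    rw [← ofFamHom_id]
    congr 1
    · simp
    · refine Function.hfunext rfl ?_
      rintro (i | i) _ ⟨⟩ <;> rfl
  map_comp f g := by
    refine ofFamHom_comp _ _ _ _ _ _ _ _ _ ?_ ?_
    · rintro (i | i) <;> rfl
    · rintro (i | i) <;> exact Category.comp_id _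

/-- Flattening of tuples of tuples, `(x₁, …, xₙ) ↦ x₁ · … · xₙ` (the enumeration
`finSigmaFinEquiv` is the lexicographic one). -/
def flatten : Fock (Fock A) ⥤ Fock A where
  obj α := ofFam finSigmaFinEquiv (fun p : (i : Fin α.len) × Fin (α.get i).len =>
    (α.get p.1).get p.2)
  map {α β} f := ofFamHom finSigmaFinEquiv finSigmaFinEquiv
    (Equiv.sigmaCongr f.perm (fun i => (f.app i).perm)) (fun p => (f.app p.1).app p.2)
  map_id α := by
    rw [← ofFamHom_id]
    congr 1
  map_comp f g := by
    exact ofFamHom_comp _ _ _ _ _ _ _ _ _ (fun _ => rfl) (fun _ => Category.comp_id _)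

/-- The functor `!A ⥤ Set` sending a tuple `z` to the product `∏ i, P (z i)`. -/
def piFunctor (P : A ⥤ Type u) : Fock A ⥤ Type u where
  obj z := ∀ i, P.obj (z.get i)
  map f := ↾fun p j => P.map (Hom.appTo f j) (p (f.perm.symm j))
  map_id z := by
    refine ConcreteCategory.hom_ext _ _ (fun p => funext fun j => ?_)
    change P.map (Hom.appTo (𝟙 z) j) (p j) = p j
    refine (congrArg (fun m => P.map m (p j)) (appTo_id z j)).trans ?_
    simp
  map_comp f g := by
    refine ConcreteCategory.hom_ext _ _ (fun p => funext fun j => ?_)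
    change P.map (Hom.appTo (f ≫ g) j) (p (f.perm.symm (g.perm.symm j))) =
      P.map (Hom.appTo g j) (P.map (Hom.appTo f _) (p (f.perm.symm (g.perm.symm j))))
    refine (congrArg (fun m => P.map m (p (f.perm.symm (g.perm.symm j))))
      (appTo_comp f g j)).trans ?_
    simp

end Cat

section Func

variable {A B : Type u} [SmallCategory A] [SmallCategory B]

/-- The action of `!` on functors. -/
def mapFunctor (F : A ⥤ B) : Fock A ⥤ Fock B where
  obj x := ⟨x.len, fun i => F.obj (x.get i)⟩
  map f := ⟨f.perm, fun i => F.map (f.app i)⟩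
  map_id x := hom_ext (fun _ => rfl) (fun _ => by simp)
  map_comp f g := hom_ext (fun _ => rfl) (fun _ => by simp)

/-- The canonical functor `!(Aᵒᵖ) ⥤ (!A)ᵒᵖ`, the identity on objects. -/
def unopFunctor : Fock Aᵒᵖ ⥤ (Fock A)ᵒᵖ where
  obj z := op ⟨z.len, fun i => (z.get i).unop⟩
  map {z w} f := Quiver.Hom.op
    (show (⟨w.len, fun i => (w.get i).unop⟩ : Fock A) ⟶ ⟨z.len, fun i => (z.get i).unop⟩ from
      ⟨f.perm.symm, fun j => (Hom.appTo f j).unop⟩)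
  map_id z := by
    apply Quiver.Hom.unop_inj
    refine hom_ext (fun _ => rfl) (fun j => ?_)
    simp [appTo_id]
  map_comp f g := by
    apply Quiver.Hom.unop_inj
    refine hom_ext (fun _ => rfl) (fun j => ?_)
    simp [appTo_comp]

end Func

end Fock

/-! ### Coends and profunctors -/

section Coend

variable {D J : Type u} [SmallCategory D] [SmallCategory J]

/-- The bifunctor `(j', j) ↦ P j × Q j'`. -/
def prodBifunctor (P : J ⥤ Type u) (Q : Jᵒᵖ ⥤ Type u) : Jᵒᵖ ⥤ J ⥤ Type u where
  obj j' :=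
    { obj := fun j => P.obj j × Q.obj j'
      map := fun f => ↾(Prod.map (P.map f) id)
      map_id := fun j => by ext x <;> simp
      map_comp := fun f g => by ext x <;> simp }
  map g :=
    { app := fun j => ↾(Prod.map id (Q.map g))
      naturality := fun _ _ f => by ext x <;> simp }
  map_id j' := by ext j x <;> simp
  map_comp f g := by ext j x <;> simp

/-- The coend `d ↦ ∫^{j : J} P d j × Q d j`, functorial in a parameter `d`. -/
def coendProd (P : D ⥤ J ⥤ Type u) (Q : D ⥤ Jᵒᵖ ⥤ Type u) : D ⥤ Type u where
  obj d := Limits.Types.coend.{u} (prodBifunctor (P.obj d) (Q.obj d))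
  map {d e} f := ↾(Quot.map (fun x => ⟨x.1, (P.map f).app x.1 x.2.1, (Q.map f).app (op x.1) x.2.2⟩)
    (by
      rintro _ _ ⟨g, x⟩
      have := Limits.Types.coendRel.mk.{u} (F := prodBifunctor (P.obj e) (Q.obj e)) g
        ⟨(P.map f).app _ x.1, (Q.map f).app _ x.2⟩
      convert this using 2
      · exact congrArg (fun y => (⟨_, ((P.map f).app _ x.1, y)⟩ :
          (j : J) × ((P.obj e).obj j × (Q.obj e).obj (op j))))
          (ConcreteCategory.congr_hom ((Q.map f).naturality g.op) x.2)
      · exact congrArg (fun y => (⟨_, (y, (Q.map f).app _ x.2)⟩ :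
          (j : J) × ((P.obj e).obj j × (Q.obj e).obj (op j))))
          (ConcreteCategory.congr_hom ((P.map f).naturality g) x.1)))
  map_id d := by
    refine ConcreteCategory.hom_ext _ _ (fun x => ?_)
    induction x using Quot.ind with | mk x =>
    refine congrArg (Quot.mk _) ?_
    simp
    rfl
  map_comp f g := by
    refine ConcreteCategory.hom_ext _ _ (fun x => ?_)
    induction x using Quot.ind with | mk x =>
    refine congrArg (Quot.mk _) ?_
    simp

end Coend

/-- The one-object category `1`, unit of the tensor product of profunctors. -/
abbrev One : Type u := Discrete PUnit.{u + 1}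

/-- The empty category `0`. -/
abbrev Zero : Type u := Discrete PEmpty.{u + 1}

/-- Profunctors `A ⇸ B`. -/
abbrev Prof (A B : Type u) [SmallCategory A] [SmallCategory B] := Aᵒᵖ × B ⥤ Type u

namespace Prof

variable {A B C D : Type u} [SmallCategory A] [SmallCategory B] [SmallCategory C] [SmallCategory D]

/-- Composition of profunctors in diagrammatic order,
`(S.comp T)(a, c) = ∫^{b : B} S(a, b) × T(b, c)`. -/
def comp (S : Prof A B) (T : Prof B C) : Prof A C :=
  coendProd (CategoryTheory.Prod.fst Aᵒᵖ C ⋙ Functor.curry.obj S)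
    (CategoryTheory.Prod.snd Aᵒᵖ C ⋙ Functor.curry.obj (CategoryTheory.Prod.swap C Bᵒᵖ ⋙ T))

/-- The identity profunctor `(a, a') ↦ A(a, a')`. -/
def id (A : Type u) [SmallCategory A] : Prof A A := Functor.hom A

/-- The profunctor `A ⇸ B`, `(a, b) ↦ B(F a, b)`, of a functor `F : A ⥤ B`. -/
def rep (F : A ⥤ B) : Prof A B := Functor.prod F.op (𝟭 B) ⋙ Functor.hom B

/-- The profunctor `B ⇸ A`, `(b, a) ↦ B(b, F a)`, of a functor `F : A ⥤ B`. -/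
def corep (F : A ⥤ B) : Prof B A := Functor.prod (𝟭 Bᵒᵖ) F ⋙ Functor.hom B

/-- The tensor product of profunctors, `((a, c), (b, d)) ↦ S(a, b) × T(c, d)`. -/
def tensor (S : Prof A B) (T : Prof C D) : Prof (A × C) (B × D) :=
  FunctorToTypes.prod
    (Functor.prod (CategoryTheory.Prod.fst A C).op (CategoryTheory.Prod.fst B D) ⋙ S)
    (Functor.prod (CategoryTheory.Prod.snd A C).op (CategoryTheory.Prod.snd B D) ⋙ T)

/-- A presheaf in `Set^A` as a profunctor `1 ⇸ A`. -/
def ofPresheaf (V : A ⥤ Type u) : Prof One.{u} A := CategoryTheory.Prod.snd One.{u}ᵒᵖ A ⋙ V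

/-- A profunctor `1 ⇸ A` as a presheaf in `Set^A`. -/
def toPresheaf (T : Prof One.{u} A) : A ⥤ Type u :=
  (Functor.curry.obj T).obj (op (Discrete.mk PUnit.unit))

/-! ### The structure of the combinatorial Fock space -/

/-- The action of `!` on profunctors,
`(!T)(x, y) = ∫^{z : !(Aᵒᵖ × B)} (∏ i, T (z i)) × !A(x, !π₁ z) × !B(!π₂ z, y)`. -/
def bang (T : Prof A B) : Prof (Fock A) (Fock B) :=
  coendProd (J := Fock (Aᵒᵖ × B)) ((Functor.const _).obj (Fock.piFunctor T))
    { obj := fun p =>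
        { obj := fun z =>
            (p.1.unop ⟶ ((Fock.mapFunctor (CategoryTheory.Prod.fst Aᵒᵖ B) ⋙ Fock.unopFunctor).obj z.unop).unop) ×
              ((Fock.mapFunctor (CategoryTheory.Prod.snd Aᵒᵖ B)).obj z.unop ⟶ p.2)
          map := fun g => ↾fun h =>
            (h.1 ≫ ((Fock.mapFunctor (CategoryTheory.Prod.fst Aᵒᵖ B) ⋙ Fock.unopFunctor).map g.unop).unop,
              (Fock.mapFunctor (CategoryTheory.Prod.snd Aᵒᵖ B)).map g.unop ≫ h.2)
          map_id := fun z => by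
            refine ConcreteCategory.hom_ext _ _ (fun h => ?_)
            refine Prod.ext ?_ ?_
            · change h.1 ≫ _ = h.1
              rw [unop_id, CategoryTheory.Functor.map_id, unop_id, Category.comp_id]
            · change _ ≫ h.2 = h.2
              rw [unop_id, CategoryTheory.Functor.map_id, Category.id_comp]
          map_comp := fun f g => by
            refine ConcreteCategory.hom_ext _ _ (fun h => ?_)
            refine Prod.ext ?_ ?_
            · change h.1 ≫ _ = (h.1 ≫ _) ≫ _
              rw [unop_comp, CategoryTheory.Functor.map_comp, unop_comp, Category.assoc]
            · change _ ≫ h.2 = _ ≫ _ ≫ h.2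
              rw [unop_comp, CategoryTheory.Functor.map_comp, Category.assoc] }
      map := fun f =>
        { app := fun z => ↾fun h => (f.1.unop ≫ h.1, h.2 ≫ f.2)
          naturality := fun _ _ g => by
            refine ConcreteCategory.hom_ext _ _ (fun h => ?_)
            exact Prod.ext (Category.assoc _ _ _).symm (Category.assoc _ _ _) }
      map_id := fun p => by
        refine NatTrans.ext (funext fun z => ConcreteCategory.hom_ext _ _ (fun h => ?_))
        exact Prod.ext (Category.id_comp _) (Category.comp_id _)
      map_comp := fun f g => by
        refine NatTrans.ext (funext fun z => ConcreteCategory.hom_ext _ _ (fun h => ?_))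
        exact Prod.ext (Category.assoc _ _ _) (Category.assoc _ _ _).symm }

/-- The vacuum `1 ⇸ !A`, `(*, x) ↦ !A((), x)`. -/
def vacuum (A : Type u) [SmallCategory A] : Prof One.{u} (Fock A) :=
  rep ((Functor.const _).obj Fock.nil)

/-- The comultiplication `δ : !A ⇸ !!A`, `(x, α) ↦ !A(x, flatten α)`. -/
def delta (A : Type u) [SmallCategory A] : Prof (Fock A) (Fock (Fock A)) := corep Fock.flatten

/-- The multiplication `μ : !!A ⇸ !A`, `(α, x) ↦ !A(flatten α, x)`. -/
def mu (A : Type u) [SmallCategory A] : Prof (Fock (Fock A)) (Fock A) := rep Fock.flatten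

/-- The equivalence `φ : 1 ⇸ !0`, with value a singleton. -/
def phi : Prof One.{u} (Fock Zero.{u}) := (Functor.const _).obj PUnit.{u + 1}

/-- The inverse `!0 ⇸ 1` of `φ`. -/
def phiInv : Prof (Fock Zero.{u}) One.{u} := (Functor.const _).obj PUnit.{u + 1}

/-- The creation operator `A × !A ⇸ !A`, `((a, x), y) ↦ !A(x · (a), y)`. -/
def creation (A : Type u) [SmallCategory A] : Prof (A × Fock A) (Fock A) :=
  rep (Functor.prod' (CategoryTheory.Prod.snd A (Fock A)) (CategoryTheory.Prod.fst A (Fock A) ⋙ Fock.single) ⋙ Fock.concat)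

/-- The creation operator `!A ≅ 1 × !A ⇸ A × !A ⇸ !A` of a vector `V : 1 ⇸ A`. -/
def creationOf (V : Prof One.{u} A) : Prof (Fock A) (Fock A) :=
  (rep (Functor.prod' ((Functor.const _).obj (Discrete.mk PUnit.unit)) (𝟭 (Fock A)))).comp
    ((V.tensor (Prof.id (Fock A))).comp (creation A))

/-- The Kleisli extension `!X ⇸ !!X ⇸ !A` of `T : !X ⇸ A`. -/
def kleisliExt (T : Prof (Fock A) B) : Prof (Fock A) (Fock B) := (delta A).comp T.bang

/-- The exponential `exp_M(T) : !X ⇸ !A ⇸ A` of `T : !X ⇸ A` with respect to the structure map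
`M : !A ⇸ A` of a pseudo `!`-algebra. -/
def exp (M : Prof (Fock B) B) (T : Prof (Fock A) B) : Prof (Fock A) B := (kleisliExt T).comp M

/-- The coherent state extension `1 ≅ !0 ⇸ !!0 ≅ !1 ⇸ !A` of a vector `V : 1 ⇸ A`. -/
def ext (V : Prof One.{u} A) : Prof One.{u} (Fock A) :=
  phi.comp ((delta Zero.{u}).comp (phiInv.bang.comp V.bang))

end Prof

/-- The presheaf `∫^{x : !A} (∏ i, V (x i)) · |x⟩` on `!A`, where `|x⟩ = !A(x, -)` and `S · |x⟩` is
the copower `S × !A(x, -)`. -/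
def ketExpansion {A : Type u} [SmallCategory A] (V : A ⥤ Type u) : Fock A ⥤ Type u :=
  coendProd ((Functor.const _).obj (Fock.piFunctor V)) yoneda

end FockSpace

/-! All three objects are the presheaf y ↦ ∏ V(y_i), that is, `Fock.piFunctor V`. For the ket
expansion this is the co-Yoneda lemma.

For the exponential, an element of exp_μ(T)((), y) is a family t_i ∈ T(x_i, y_i), a morphism from ()
to the concatenation of the x_i, and a morphism from the concatenation of the y_i to y. The first
morphism forces every x_i to be empty. When T is the creation operator of V, an element of T((),
y_i) is a vector v ∈ V a pushed forward along some (a) → y_i (`creation_ind`). The family is thus a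
tuple of vectors, one for each of several one-entry tuples, and flattening one-entry tuples gives
back the tuple of their entries (`creationPi_surjective`). For ext V, the coends over !0, !!0 and !1
collapse because these categories are built from 0 and 1; only the values of !V remain
(`extMk_surjective`).

Separating classes in iterated coends by their relations would be painful. Instead, `Act` packages a
natural map T ∘ P → Q; such maps compose along with profunctors and pass through `!`. This yields an
evaluation of each side in ∏ V(y_i). Each p has a canonical element that evaluates to p, and every
element is canonical, so evaluation is bijective and `Act.nonempty_iso_of_bijective` applies. Coend
relations are used in the proof only to bring elements to canonical form and to see that evaluation
is well defined. -/

namespace FockSpace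

/-! ### Products of values over tuples -/

namespace Fock

variable {A B : Type u} [SmallCategory A] [SmallCategory B]

/-- The action of `piFunctor` is defined by entries of the target, which costs a transport along
`f.perm.symm`. Reading it at the image of a source entry removes the transport. -/
theorem piFunctor_map_perm (P : A ⥤ Type u) {x y : Fock A} (f : x ⟶ y)
    (p : (piFunctor P).obj x) (i : Fin x.len) :
    (piFunctor P).map f p (f.perm i) = P.map (f.app i) (p i) := by
  have key : ∀ {k l : Fin x.len} (h : k = l) (h' : y.get (f.perm k) = y.get (f.perm l)),
      P.map (f.app k ≫ eqToHom h') (p k) = P.map (f.app l) (p l) := by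
    rintro k _ rfl h'
    simp
  exact key (f.perm.symm_apply_apply i) _

theorem piFunctor_map_eq_iff (P : A ⥤ Type u) {x y : Fock A} (f : x ⟶ y)
    (p : (piFunctor P).obj x) (q : (piFunctor P).obj y) :
    (piFunctor P).map f p = q ↔ ∀ i, P.map (f.app i) (p i) = q (f.perm i) := by
  refine ⟨fun h i => by rw [← h, piFunctor_map_perm], fun h => funext fun j => ?_⟩
  obtain ⟨i, rfl⟩ := f.perm.surjective j
  rw [piFunctor_map_perm, h]

/-- Lets concatenation and flattening be computed on sums and sigma types of indices, without
touching their enumerations by `Fin`. -/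
theorem piFunctor_map_ofFamHom (P : A ⥤ Type u) {I J : Type} {m n : ℕ} (e : I ≃ Fin m)
    (e' : J ≃ Fin n) {a : I → A} {b : J → A} (τ : I ≃ J) (φ : ∀ i, a i ⟶ b (τ i))
    (p : ∀ i, P.obj (a i)) (q : ∀ j, P.obj (b j))
    (h : ∀ i, P.map (φ i) (p i) = q (τ i)) :
    (piFunctor P).map (ofFamHom e e' τ φ) (fun k => p (e.symm k)) = fun k => q (e'.symm k) := by
  refine (piFunctor_map_eq_iff _ _ _ _).2 fun k => ?_
  have key : ∀ {j j' : J} (h : j = j'),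
      P.map (eqToHom (congrArg b h)) (q j) = q j' := by
    rintro j _ rfl
    simp
  refine (Functor.map_comp_apply P _ _ _).trans ?_
  rw [h]
  exact key (e'.symm_apply_apply (τ (e.symm k))).symm

theorem piFunctor_map_concat (P : A ⥤ Type u) {x y x' y' : Fock A} (f : x ⟶ x') (g : y ⟶ y')
    (p : ∀ s, P.obj (Sum.elim x.get y.get s)) (q : ∀ s, P.obj (Sum.elim x'.get y'.get s))
    (hf : ∀ i, P.map (f.app i) (p (Sum.inl i)) = q (Sum.inl (f.perm i)))
    (hg : ∀ i, P.map (g.app i) (p (Sum.inr i)) = q (Sum.inr (g.perm i))) :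
    (piFunctor P).map (concat.map (Prod.mkHom f g : (x, y) ⟶ (x', y')))
      (fun k => p (finSumFinEquiv.symm k)) = fun k => q (finSumFinEquiv.symm k) := by
  unfold concat
  dsimp only
  refine piFunctor_map_ofFamHom P finSumFinEquiv finSumFinEquiv _ _ p q ?_
  rintro (i | i)
  · exact hf i
  · exact hg i

/-- `∏ i j, P ((α i) j) ≅ ∏ k, P ((flatten α) k)`. -/
def flattenPi (P : A ⥤ Type u) : piFunctor (piFunctor P) ≅ flatten ⋙ piFunctor P :=
  NatIso.ofComponents (fun α => Equiv.toIso
    (((Equiv.piCurry (fun i j => P.obj ((α.get i).get j))).symm.trans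
      (Equiv.piCongrLeft' (fun p : (i : Fin α.len) × Fin (α.get i).len =>
        P.obj ((α.get p.1).get p.2)) finSigmaFinEquiv)) :
      (∀ i j, P.obj ((α.get i).get j)) ≃ _)) (fun {α β} f => by
    refine ConcreteCategory.hom_ext _ _ (fun p => ?_)
    refine (piFunctor_map_ofFamHom P finSigmaFinEquiv finSigmaFinEquiv
      (a := fun p : (i : Fin α.len) × Fin (α.get i).len => (α.get p.1).get p.2)
      (b := fun p : (i : Fin β.len) × Fin (β.get i).len => (β.get p.1).get p.2)
      (Equiv.sigmaCongr f.perm (fun i => (f.app i).perm)) (fun p => (f.app p.1).app p.2)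
      (fun q => p q.1 q.2) (fun q => (piFunctor (piFunctor P)).map f p q.1 q.2) ?_).symm
    rintro ⟨i, j⟩
    change _ = (piFunctor (piFunctor P)).map f p (f.perm i) ((f.app i).perm j)
    rw [piFunctor_map_perm, piFunctor_map_perm]
    rfl)

end Fock

/-! ### Elements of coends -/

section Coend

variable {J : Type u} [SmallCategory J] {P : J ⥤ Type u} {Q : Jᵒᵖ ⥤ Type u}

/-- The class of a pair in the coend `∫^{j : J} P j × Q j`. -/
def coendMk (j : J) (p : P.obj j) (q : Q.obj (op j)) :
    Limits.Types.coend.{u} (prodBifunctor P Q) :=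
  Quot.mk _ ⟨j, p, q⟩

theorem coendMk_sound {j j' : J} (g : j ⟶ j') (p : P.obj j) (q : Q.obj (op j')) :
    coendMk j' (P.map g p) q = coendMk j p (Q.map g.op q) :=
  (Quot.sound (Limits.Types.coendRel.mk.{u} (F := prodBifunctor P Q) g ⟨p, q⟩)).symm

theorem coend_ind (x : Limits.Types.coend.{u} (prodBifunctor P Q)) :
    ∃ j p q, x = coendMk j p q := by
  obtain ⟨⟨j, p, q⟩, rfl⟩ := Quot.exists_rep x
  exact ⟨j, p, q, rfl⟩

/-- Maps out of a coend. -/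
def coendLift {X : Type u} (f : ∀ j, P.obj j → Q.obj (op j) → X)
    (hf : ∀ {j j' : J} (g : j ⟶ j') (p : P.obj j) (q : Q.obj (op j')),
      f j' (P.map g p) q = f j p (Q.map g.op q))
    (x : Limits.Types.coend.{u} (prodBifunctor P Q)) : X :=
  Quot.lift (fun y => f y.1 y.2.1 y.2.2) (by
    rintro _ _ ⟨g, p, q⟩
    exact (hf g p q).symm) x

end Coend

/-! ### Profunctors acting on presheaves -/

namespace Prof

variable {A B C D : Type u} [SmallCategory A] [SmallCategory B] [SmallCategory C] [SmallCategory D]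

/-- The class of a pair in a composite of profunctors. -/
def compMk {S : Prof A B} {T : Prof B C} {a : A} {c : C} (b : B) (s : S.obj (op a, b))
    (t : T.obj (op b, c)) : (S.comp T).obj (op a, c) :=
  coendMk (P := (Functor.curry.obj S).obj (op a))
    (Q := (Functor.curry.obj (CategoryTheory.Prod.swap C Bᵒᵖ ⋙ T)).obj c) b s t

/-- The covariant action on a profunctor. -/
def post (T : Prof A B) {a : A} {b b' : B} (g : b ⟶ b') (t : T.obj (op a, b)) : T.obj (op a, b') :=
  T.map (Prod.mkHom (𝟙 (op a)) g) t

/-- The contravariant action on a profunctor. -/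
def pre (T : Prof A B) {a a' : A} {b : B} (f : a' ⟶ a) (t : T.obj (op a, b)) : T.obj (op a', b) :=
  T.map (Prod.mkHom f.op (𝟙 b)) t

theorem map_eq_pre_post (T : Prof A B) {a a' : A} {b b' : B} (f : a' ⟶ a) (g : b ⟶ b')
    (t : T.obj (op a, b)) :
    T.map (Prod.mkHom f.op g : (op a, b) ⟶ (op a', b')) t = T.pre f (T.post g t) := by
  unfold pre post
  rw [← Functor.map_comp_apply]
  congr 2
  ext
  simp

theorem compMk_sound {S : Prof A B} {T : Prof B C} {a : A} {c : C} {b b' : B} (g : b ⟶ b')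
    (s : S.obj (op a, b)) (t : T.obj (op b', c)) :
    (compMk b' (S.post g s) t : (S.comp T).obj (op a, c)) = compMk b s (T.pre g t) :=
  coendMk_sound (P := (Functor.curry.obj S).obj (op a))
    (Q := (Functor.curry.obj (CategoryTheory.Prod.swap C Bᵒᵖ ⋙ T)).obj c) g s t

theorem comp_ind {S : Prof A B} {T : Prof B C} {a : A} {c : C} (x : (S.comp T).obj (op a, c)) :
    ∃ b s t, x = compMk (S := S) (T := T) b s t :=
  coend_ind (P := (Functor.curry.obj S).obj (op a))
    (Q := (Functor.curry.obj (CategoryTheory.Prod.swap C Bᵒᵖ ⋙ T)).obj c) x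

theorem comp_post {S : Prof A B} {T : Prof B C} {a : A} {c c' : C} (g : c ⟶ c') (b : B)
    (s : S.obj (op a, b)) (t : T.obj (op b, c)) :
    (S.comp T).post g (compMk b s t) = compMk b s (T.post g t) := by
  refine Eq.trans rfl (congrArg (fun s => compMk b s _) ?_)
  exact Functor.map_id_apply S _ s

theorem comp_pre {S : Prof A B} {T : Prof B C} {a a' : A} {c : C} (f : a' ⟶ a) (b : B)
    (s : S.obj (op a, b)) (t : T.obj (op b, c)) :
    (S.comp T).pre f (compMk b s t) = compMk b (S.pre f s) t := by
  refine Eq.trans rfl (congrArg (fun t => compMk b _ t) ?_)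
  exact Functor.map_id_apply T _ t

/-- A natural map `P b × T(b, c) → Q c`, i.e. a map of presheaves `T ∘ P → Q`. -/
structure Act (T : Prof A B) (P : A ⥤ Type u) (Q : B ⥤ Type u) where
  act : ∀ {a : A} {b : B}, T.obj (op a, b) → P.obj a → Q.obj b
  act_post : ∀ {a : A} {b b' : B} (g : b ⟶ b') (t : T.obj (op a, b)) (p : P.obj a),
    act (T.post g t) p = Q.map g (act t p)
  act_pre : ∀ {a a' : A} {b : B} (f : a' ⟶ a) (t : T.obj (op a, b)) (p : P.obj a'),
    act (T.pre f t) p = act t (P.map f p)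

namespace Act

theorem act_map {T : Prof A B} {P : A ⥤ Type u} {Q : B ⥤ Type u} (F : Act T P Q) {a a' : A}
    {b b' : B} (f : a' ⟶ a) (g : b ⟶ b') (t : T.obj (op a, b)) (p : P.obj a') :
    F.act (T.map (Prod.mkHom f.op g : (op a, b) ⟶ (op a', b')) t) p =
      Q.map g (F.act t (P.map f p)) := by
  rw [map_eq_pre_post, F.act_pre, F.act_post]

/-- Action of a composite. -/
def comp {S : Prof A B} {T : Prof B C} {P : A ⥤ Type u} {Q : B ⥤ Type u} {R : C ⥤ Type u}
    (F : Act S P Q) (G : Act T Q R) : Act (S.comp T) P R where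
  act {a c} x p := coendLift (P := (Functor.curry.obj S).obj (op a))
    (Q := (Functor.curry.obj (CategoryTheory.Prod.swap C Bᵒᵖ ⋙ T)).obj c) (fun b s t => G.act (a := b) t (F.act (a := a) s p)) (fun g s t => by
    exact (congrArg (G.act t) (F.act_post g s p)).trans (G.act_pre g t (F.act s p)).symm) x
  act_post g x p := by
    obtain ⟨b, s, t, rfl⟩ := comp_ind x
    rw [comp_post]
    exact G.act_post g t _
  act_pre f x p := by
    obtain ⟨b, s, t, rfl⟩ := comp_ind x
    rw [comp_pre]
    exact congrArg (G.act t) (F.act_pre f s p)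

/-- Action of the profunctor of a functor. -/
def rep (F : A ⥤ B) {P : A ⥤ Type u} {Q : B ⥤ Type u} (θ : P ⟶ F ⋙ Q) :
    Act (Prof.rep F) P Q where
  act {a b} f p := Q.map (show F.obj a ⟶ b from f) (θ.app a p)
  act_post {a b b'} g f p := by
    change F.obj a ⟶ b at f
    change Q.map (F.map (𝟙 a) ≫ f ≫ g) _ = Q.map g (Q.map f _)
    simp
  act_pre {a a' b} g f p := by
    change F.obj a ⟶ b at f
    change Q.map (F.map g ≫ f ≫ 𝟙 b) _ = Q.map f _
    have := ConcreteCategory.congr_hom (θ.naturality g) p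
    dsimp at this
    simp [this]

/-- Action of the opposite profunctor of a functor. -/
def corep (F : A ⥤ B) {P : B ⥤ Type u} {Q : A ⥤ Type u} (θ : F ⋙ P ⟶ Q) :
    Act (Prof.corep F) P Q where
  act {b a} f p := θ.app a (P.map (show b ⟶ F.obj a from f) p)
  act_post {b a a'} g f p := by
    change b ⟶ F.obj a at f
    change θ.app a' (P.map (𝟙 b ≫ f ≫ F.map g) _) = Q.map g (θ.app a (P.map f _))
    have := ConcreteCategory.congr_hom (θ.naturality g) (P.map f p)
    dsimp at this
    simp [this]
  act_pre {b b' a} g f p := by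
    change b ⟶ F.obj a at f
    change θ.app a (P.map (g ≫ f ≫ F.map (𝟙 a)) _) = θ.app a (P.map f _)
    simp

end Act

/-- The tuple of first components of a tuple in `!(Aᵒᵖ × B)`. -/
abbrev srcs (z : Fock (Aᵒᵖ × B)) : Fock A := ⟨z.len, fun i => (z.get i).1.unop⟩

/-- The tuple of second components of a tuple in `!(Aᵒᵖ × B)`. -/
abbrev tgts (z : Fock (Aᵒᵖ × B)) : Fock B := ⟨z.len, fun i => (z.get i).2⟩

/-- `!π₁` on morphisms. -/
def srcsMap {z w : Fock (Aᵒᵖ × B)} (f : z ⟶ w) : srcs w ⟶ srcs z :=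
  ((Fock.mapFunctor (CategoryTheory.Prod.fst Aᵒᵖ B) ⋙ Fock.unopFunctor).map f).unop

/-- `!π₂` on morphisms. -/
def tgtsMap {z w : Fock (Aᵒᵖ × B)} (f : z ⟶ w) : tgts z ⟶ tgts w :=
  (Fock.mapFunctor (CategoryTheory.Prod.snd Aᵒᵖ B)).map f

/-- The presheaf `z ↦ !A(x, !π₁ z) × !B(!π₂ z, y)`. -/
def bangHoms (x : Fock A) (y : Fock B) : (Fock (Aᵒᵖ × B))ᵒᵖ ⥤ Type u where
  obj z := (x ⟶ srcs z.unop) × (tgts z.unop ⟶ y)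
  map g := ↾fun h => (h.1 ≫ srcsMap g.unop, tgtsMap g.unop ≫ h.2)
  map_id z := by
    refine ConcreteCategory.hom_ext _ _ (fun h => ?_)
    refine Prod.ext ?_ ?_
    · exact (congrArg (h.1 ≫ ·) (by simp [srcsMap]; rfl)).trans (Category.comp_id h.1)
    · exact (congrArg (· ≫ h.2) (by simp [tgtsMap]; rfl)).trans (Category.id_comp h.2)
  map_comp f g := by
    refine ConcreteCategory.hom_ext _ _ (fun h => ?_)
    simp [srcsMap, tgtsMap]
    exact ⟨(Category.assoc _ _ _).symm, Category.assoc _ _ _⟩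

/-- The class of a triple in `!T`. -/
def bangMk {T : Prof A B} {x : Fock A} {y : Fock B} (z : Fock (Aᵒᵖ × B))
    (t : ∀ i, T.obj (z.get i)) (k : x ⟶ srcs z) (l : tgts z ⟶ y) : T.bang.obj (op x, y) :=
  coendMk (P := Fock.piFunctor T) (Q := bangHoms x y) z t (k, l)

theorem bangMk_sound {T : Prof A B} {x : Fock A} {y : Fock B} {z w : Fock (Aᵒᵖ × B)} (g : z ⟶ w)
    (t : ∀ i, T.obj (z.get i)) (k : x ⟶ srcs w) (l : tgts w ⟶ y) :
    (bangMk w ((Fock.piFunctor T).map g t) k l : T.bang.obj (op x, y)) =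
      bangMk z t (k ≫ srcsMap g) (tgtsMap g ≫ l) :=
  coendMk_sound (P := Fock.piFunctor T) (Q := bangHoms x y) g t (k, l)

theorem bang_ind {T : Prof A B} {x : Fock A} {y : Fock B} (e : T.bang.obj (op x, y)) :
    ∃ z t k l, e = bangMk (T := T) z t k l := by
  obtain ⟨⟨z, t, k, l⟩, rfl⟩ := Quot.exists_rep e
  exact ⟨z, t, k, l, rfl⟩

theorem bang_post {T : Prof A B} {x : Fock A} {y y' : Fock B} (g : y ⟶ y')
    (z : Fock (Aᵒᵖ × B)) (t : ∀ i, T.obj (z.get i)) (k : x ⟶ srcs z) (l : tgts z ⟶ y) :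
    T.bang.post g (bangMk z t k l) = bangMk z t k (l ≫ g) :=
  congrArg (fun k => bangMk z t k (l ≫ g)) (Category.id_comp k)

theorem bang_pre {T : Prof A B} {x x' : Fock A} {y : Fock B} (f : x' ⟶ x)
    (z : Fock (Aᵒᵖ × B)) (t : ∀ i, T.obj (z.get i)) (k : x ⟶ srcs z) (l : tgts z ⟶ y) :
    T.bang.pre f (bangMk z t k l) = bangMk z t (f ≫ k) l :=
  congrArg (fun l => bangMk z t (f ≫ k) l) (Category.comp_id l)

/-- `srcsMap g` runs backwards, with the inverse permutation of `g`, so its components carry a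
transport; indexing by the entries of `z` cancels it. -/
theorem piFunctor_map_srcsMap (P : A ⥤ Type u) {z w : Fock (Aᵒᵖ × B)} (g : z ⟶ w)
    (p : ∀ i, P.obj (w.get i).1.unop) (i : Fin z.len) :
    (Fock.piFunctor P).map (srcsMap g) p i = P.map (g.app i).1.unop (p (g.perm i)) := by
  have h : ∀ j, P.map ((srcsMap g).app j) (p j) =
      (fun i => P.map (g.app i).1.unop (p (g.perm i))) ((srcsMap g).perm j) := by
    intro j
    obtain ⟨i, rfl⟩ := g.perm.surjective j
    have key : ∀ {k : Fin z.len} (h : k = i) (h' : w.get (g.perm k) = w.get (g.perm i)),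
        P.map ((CategoryTheory.Prod.fst Aᵒᵖ B).map (g.app k) ≫
          eqToHom (congrArg Prod.fst h')).unop (p (g.perm i)) =
        P.map (g.app k).1.unop (p (g.perm k)) := by
      rintro k rfl h'
      simp
    exact key (g.perm.symm_apply_apply i) (by simp)
  exact congrFun ((Fock.piFunctor_map_eq_iff P (srcsMap g) p
    (fun i => P.map (g.app i).1.unop (p (g.perm i)))).2 h) i

/-- Action of `!T`. -/
def Act.bang {T : Prof A B} {P : A ⥤ Type u} {Q : B ⥤ Type u} (F : Act T P Q) :
    Act T.bang (Fock.piFunctor P) (Fock.piFunctor Q) where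
  act {x y} e p := coendLift (P := Fock.piFunctor T) (Q := bangHoms x y)
    (fun z t kl => (Fock.piFunctor Q).map kl.2 (fun i => F.act (a := (z.get i).1.unop) (t i)
      ((Fock.piFunctor P).map kl.1 p i))) (fun {z w} g t kl => by
    obtain ⟨k, l⟩ := kl
    change (Fock.piFunctor Q).map l _ = (Fock.piFunctor Q).map (tgtsMap g ≫ l) (fun i =>
      F.act (a := (z.get i).1.unop) (t i) ((Fock.piFunctor P).map (k ≫ srcsMap g) p i))
    refine Eq.trans (congrArg _ (Eq.symm ?_))
      ((Fock.piFunctor Q).map_comp_apply (tgtsMap g) l _).symm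
    -- Entrywise, the coend relation is the naturality of `F` in both variables along the pair
    -- `g.app i`.
    refine (Fock.piFunctor_map_eq_iff _ _ _ _).2 fun i => ?_
    refine (congrArg (fun p => Q.map _ (F.act (t i) p))
      ((congrFun ((Fock.piFunctor P).map_comp_apply k (srcsMap g) p) i).trans
      (piFunctor_map_srcsMap P g _ i))).trans ?_
    change _ = F.act ((Fock.piFunctor T).map g t (g.perm i)) _
    rw [Fock.piFunctor_map_perm]
    exact (F.act_map (g.app i).1.unop (g.app i).2 (t i) _).symm) e
  act_post g e p := by
    obtain ⟨z, t, k, l, rfl⟩ := bang_ind e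
    rw [bang_post]
    exact Functor.map_comp_apply _ _ _ _
  act_pre f e p := by
    obtain ⟨z, t, k, l, rfl⟩ := bang_ind e
    rw [bang_pre]
    refine congrArg ((Fock.piFunctor Q).map l) (funext fun i => ?_)
    exact congrArg _ (congrFun (Functor.map_comp_apply (Fock.piFunctor P) f k p) i)

end Prof

/-! ### Actions of the operators in the theorem -/

namespace Prof

variable {A B C D : Type u} [SmallCategory A] [SmallCategory B] [SmallCategory C] [SmallCategory D]

namespace Act

/-- The unique action with values in the terminal presheaf. -/
def toUnit (T : Prof A B) (P : A ⥤ Type u) : Act T P ((Functor.const B).obj PUnit) where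
  act _ _ := PUnit.unit
  act_post _ _ _ := rfl
  act_pre _ _ _ := rfl

/-- Restriction of an action along a map of presheaves. -/
def precomp {T : Prof A B} {P P' : A ⥤ Type u} {Q : B ⥤ Type u} (θ : P' ⟶ P) (F : Act T P Q) :
    Act T P' Q where
  act {a _} t p := F.act t (θ.app a p)
  act_post g t _ := F.act_post g t _
  act_pre f t p := (F.act_pre f t _).trans
    (congrArg (F.act t) (ConcreteCategory.congr_hom (θ.naturality f) p).symm)

/-- A presheaf as the result of acting on the terminal presheaf on `1`. -/
def ofPresheaf (V : A ⥤ Type u) :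
    Act (Prof.ofPresheaf V) ((Functor.const One.{u}).obj PUnit) V where
  act v _ := v
  act_post _ _ _ := rfl
  act_pre {_ _ b} _ v _ := V.map_id_apply b v

/-- Action of the identity profunctor. -/
def id (P : A ⥤ Type u) : Act (Prof.id A) P P where
  act {a b} f p := P.map (show a ⟶ b from f) p
  act_post {a b b'} g f p := by
    change a ⟶ b at f
    change P.map (𝟙 a ≫ f ≫ g) p = P.map g (P.map f p)
    simp
  act_pre {a a' b} g f p := by
    change a ⟶ b at f
    change P.map (g ≫ f ≫ 𝟙 b) p = P.map f (P.map g p)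
    simp

/-- Action of a tensor product. -/
def tensor {S : Prof A B} {T : Prof C D} {P : A ⥤ Type u} {Q : B ⥤ Type u} {P' : C ⥤ Type u}
    {Q' : D ⥤ Type u} (F : Act S P Q) (G : Act T P' Q') :
    Act (S.tensor T)
      (FunctorToTypes.prod (CategoryTheory.Prod.fst A C ⋙ P) (CategoryTheory.Prod.snd A C ⋙ P'))
      (FunctorToTypes.prod (CategoryTheory.Prod.fst B D ⋙ Q)
        (CategoryTheory.Prod.snd B D ⋙ Q')) where
  act {a b} st p := (F.act (a := a.1) (b := b.1) st.1 p.1, G.act (a := a.2) (b := b.2) st.2 p.2)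
  act_post g st p := Prod.ext (F.act_post g.1 st.1 p.1) (G.act_post g.2 st.2 p.2)
  act_pre f st p := Prod.ext (F.act_pre f.1 st.1 p.1) (G.act_pre f.2 st.2 p.2)

/-- A profunctor out of `1` with a bijective action on the point is a presheaf. -/
theorem nonempty_iso_of_bijective {T : Prof One.{u} B} {Q : B ⥤ Type u}
    (F : Act T ((Functor.const One.{u}).obj PUnit) Q)
    (h : ∀ b, Function.Bijective fun t : T.obj (op (Discrete.mk PUnit.unit), b) =>
      F.act t PUnit.unit) : Nonempty (T ≅ Prof.ofPresheaf Q) :=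
  ⟨NatIso.ofComponents (fun X => (Equiv.ofBijective _ (h X.2)).toIso) (fun f =>
    ConcreteCategory.hom_ext _ _ fun t => F.act_map f.1.unop f.2 t PUnit.unit)⟩

end Act

/-- Adjoining an entry with a given value, `V a × ∏ i, V (x i) → ∏ i, V ((x · (a)) i)`. -/
def adjoinPi (V : A ⥤ Type u) :
    FunctorToTypes.prod (CategoryTheory.Prod.fst A (Fock A) ⋙ V)
      (CategoryTheory.Prod.snd A (Fock A) ⋙ Fock.piFunctor V) ⟶
    (Functor.prod' (CategoryTheory.Prod.snd A (Fock A))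
      (CategoryTheory.Prod.fst A (Fock A) ⋙ Fock.single) ⋙ Fock.concat) ⋙ Fock.piFunctor V where
  app ax := ↾fun vp k => Sum.rec (motive := fun s => V.obj
      (Sum.elim ax.2.get (fun _ : Fin 1 => ax.1) s)) vp.2 (fun _ => vp.1) (finSumFinEquiv.symm k)
  naturality ax bz f := by
    refine ConcreteCategory.hom_ext _ _ fun vp => Eq.symm ?_
    exact Fock.piFunctor_map_concat V f.2 (Fock.single.map f.1)
      (fun s => Sum.rec (motive := fun s => V.obj
        (Sum.elim ax.2.get (fun _ : Fin 1 => ax.1) s)) vp.2 (fun _ => vp.1) s)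
      (fun s => Sum.rec (motive := fun s => V.obj
        (Sum.elim bz.2.get (fun _ : Fin 1 => bz.1) s)) ((Fock.piFunctor V).map f.2 vp.2)
          (fun _ => V.map f.1 vp.1) s)
      (fun i => (Fock.piFunctor_map_perm V f.2 vp.2 i).symm) (fun _ => rfl)

/-- Evaluation of the coherent state extension. -/
def extAct (V : A ⥤ Type u) :
    Act (ext (ofPresheaf V)) ((Functor.const One.{u}).obj PUnit) (Fock.piFunctor V) :=
  -- Only the last factor `!V` carries data, so all presheaves before it may be taken terminal.
  (Act.toUnit _ _).comp ((Act.toUnit _ _).comp ((Act.toUnit _ _).comp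
    ((Act.ofPresheaf V).bang.precomp
      { app := fun _ => ↾fun _ _ => PUnit.unit
        naturality := fun _ _ _ => rfl })))

end Prof

/-! ### Unit isomorphisms for concatenation and flattening -/

namespace Fock

variable {A B : Type u} [SmallCategory A] [SmallCategory B]

theorem appTo_perm {x y : Fock A} (f : x ⟶ y) (i : Fin x.len) :
    Hom.appTo f (f.perm i) =
      eqToHom (congrArg x.get (f.perm.symm_apply_apply i)) ≫ f.app i := by
  rw [Hom.appTo, eqToHom_app f (f.perm.symm_apply_apply i)]

theorem isIso_of_app {x y : Fock A} (f : x ⟶ y) (h : ∀ i, IsIso (f.app i)) : IsIso f := by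
  have hj : ∀ j, IsIso (Hom.appTo f j) := fun j => IsIso.comp_isIso' (h _) inferInstance
  refine ⟨⟨f.perm.symm, fun j => inv (Hom.appTo f j)⟩, ?_, ?_⟩
  · refine hom_ext (fun i => by simp) (fun i => ?_)
    change (f.app i ≫ inv (Hom.appTo f (f.perm i))) ≫ eqToHom _ = 𝟙 _
    have : inv (Hom.appTo f (f.perm i)) = inv (f.app i) ≫
        eqToHom (congrArg x.get (f.perm.symm_apply_apply i).symm) := by
      refine IsIso.inv_eq_of_hom_inv_id ?_
      rw [appTo_perm]
      simp
    rw [this]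
    simp only [IsIso.hom_inv_id_assoc]
    exact (eqToHom_trans _ _).trans (eqToHom_refl _ _)
  · refine hom_ext (fun i => by simp) (fun j => ?_)
    change (inv (Hom.appTo f j) ≫ f.app (f.perm.symm j)) ≫ eqToHom _ = 𝟙 _
    rw [Category.assoc]
    exact IsIso.inv_hom_id (Hom.appTo f j)

theorem ofFamHom_isIso {I J : Type} {m n : ℕ} (e : I ≃ Fin m) (e' : J ≃ Fin n) {a : I → A}
    {b : J → A} (τ : I ≃ J) (φ : ∀ i, a i ⟶ b (τ i)) [∀ i, IsIso (φ i)] :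
    IsIso (ofFamHom e e' τ φ) :=
  isIso_of_app _ fun k => by
    exact IsIso.comp_isIso' (inferInstanceAs (IsIso (φ (e.symm k))))
      (inferInstanceAs (IsIso (eqToHom (congrArg b (e'.symm_apply_apply (τ (e.symm k))).symm))))

/-- Puts an arbitrary morphism in the form to which `ofFamHom_comp` applies, so that the naturality
squares below become comparisons of index families. -/
theorem ofFamHom_refl {x y : Fock A} (f : x ⟶ y) :
    (ofFamHom (Equiv.refl _) (Equiv.refl _) f.perm f.app : x ⟶ y) = f :=
  hom_ext (fun _ => rfl) fun i => by
    change (f.app i ≫ 𝟙 _) ≫ 𝟙 _ = f.app i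
    exact (Category.comp_id _).trans (Category.comp_id _)

/-- `() · (a) ⟶ (a)`. -/
def nilConcat (a : A) : concat.obj (nil, single.obj a) ⟶ single.obj a :=
  ofFamHom finSumFinEquiv (Equiv.refl (Fin 1)) (Equiv.emptySum (Fin 0) (Fin 1))
    (b := fun _ => a) (fun s => match s with
      | Sum.inl i => Fin.elim0 i
      | Sum.inr _ => 𝟙 a)

theorem piFunctor_map_nilConcat (P : A ⥤ Type u) {a : A}
    (p : ∀ s, P.obj (Sum.elim (nil : Fock A).get (fun _ : Fin 1 => a) s)) :
    (piFunctor P).map (nilConcat a) (fun k => p (finSumFinEquiv.symm k)) =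
      fun _ => p (Sum.inr 0) := by
  unfold nilConcat
  refine piFunctor_map_ofFamHom P finSumFinEquiv (Equiv.refl (Fin 1)) _ _ p
    (fun _ => p (Sum.inr 0)) ?_
  rintro (i | i)
  · exact Fin.elim0 i
  · obtain rfl := Subsingleton.elim i 0
    exact P.map_id_apply a _

instance (a : A) : IsIso (nilConcat a) :=
  @ofFamHom_isIso _ _ _ _ _ _ _ _ _ _ _ _ (by
    rintro (i | i)
    · exact Fin.elim0 i
    · exact inferInstanceAs (IsIso (𝟙 a)))

theorem nilConcat_naturality {a b : A} (g : a ⟶ b) :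
    concat.map (Prod.mkHom (𝟙 nil) (single.map g) :
      (nil, single.obj a) ⟶ (nil, single.obj b)) ≫ nilConcat b = nilConcat a ≫ single.map g := by
  refine Eq.trans ?_ (congrArg (_ ≫ ·) (ofFamHom_refl (single.map g)))
  -- Both composites are compared with one family morphism, the diagonal of the square.
  refine (ofFamHom_comp _ _ _ _ _ _ _ (Equiv.emptySum (Fin 0) (Fin 1)) (fun s => match s with
      | Sum.inl i => Fin.elim0 i
      | Sum.inr _ => g) ?_ ?_).symm.trans (ofFamHom_comp _ _ _ _ _ _ _ _ _ ?_ ?_)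
  · rintro (i | i)
    · exact Fin.elim0 i
    · rfl
  · rintro (i | i)
    · exact Fin.elim0 i
    · rfl
  · rintro (i | i)
    · exact Fin.elim0 i
    · rfl
  · rintro (i | i)
    · exact Fin.elim0 i
    · exact (Category.comp_id g).trans (Category.id_comp g).symm

/-- `(y₁) · … · (yₙ) ⟶ (y₁, …, yₙ)`. -/
def flattenSingle (y : Fock A) : flatten.obj ((mapFunctor single).obj y) ⟶ y :=
  ofFamHom (I := (_ : Fin y.len) × Fin 1) finSigmaFinEquiv (Equiv.refl (Fin y.len))
    (a := fun p => y.get p.1) (Equiv.sigmaUnique (Fin y.len) (fun _ => Fin 1))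
    (fun p => 𝟙 (y.get p.1))

theorem piFunctor_map_flattenSingle (P : A ⥤ Type u) {y : Fock A} (p : ∀ i, P.obj (y.get i)) :
    (piFunctor P).map (flattenSingle y)
      ((flattenPi P).hom.app ((mapFunctor single).obj y) fun i _ => p i) = p :=
  piFunctor_map_ofFamHom P (I := (_ : Fin y.len) × Fin 1) finSigmaFinEquiv
    (Equiv.refl (Fin y.len)) (a := fun q => y.get q.1) (b := y.get) _ _ (fun q => p q.1) p
    (fun q => P.map_id_apply (y.get q.1) (p q.1))

instance (y : Fock A) : IsIso (flattenSingle y) :=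
  @ofFamHom_isIso _ _ _ _ _ _ _ _ _ _ _ _ fun p => inferInstanceAs (IsIso (𝟙 (y.get p.1)))

theorem flattenSingle_naturality {x y : Fock A} (f : x ⟶ y) :
    flatten.map ((mapFunctor single).map f) ≫ flattenSingle y = flattenSingle x ≫ f := by
  refine Eq.trans ?_ (congrArg (_ ≫ ·) (ofFamHom_refl f))
  refine (ofFamHom_comp _ _ _ _ _ _ _
    ((Equiv.sigmaUnique (Fin x.len) (fun _ => Fin 1)).trans f.perm) (fun p => f.app p.1)
    ?_ ?_).symm.trans (ofFamHom_comp _ _ _ _ _ _ _ _ _ ?_ ?_)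
  · exact fun _ => rfl
  · exact fun _ => rfl
  · exact fun _ => rfl
  · exact fun p => (Category.comp_id _).trans (Category.id_comp _).symm

/-- Vacuous but decisive: the morphism out of () in an element of the exponential carries no data.
-/
theorem nil_hom_eq {x : Fock A} (f g : nil ⟶ x) : f = g :=
  hom_ext (fun i => Fin.elim0 i) fun i => Fin.elim0 i

theorem len_eq {x y : Fock A} (f : x ⟶ y) : x.len = y.len :=
  Fin.equiv_iff_eq.1 ⟨f.perm⟩

/-- The morphism from the empty tuple to a tuple without entries. -/
def nilHom {x : Fock A} (h : x.len = 0) : nil ⟶ x := ⟨finCongr h.symm, fun i => Fin.elim0 i⟩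

theorem flatten_len_eq_zero_iff (α : Fock (Fock A)) :
    (flatten.obj α).len = 0 ↔ ∀ i, (α.get i).len = 0 := by
  change ∑ i, (α.get i).len = 0 ↔ _
  simp

end Fock

/-! ### The exponential of the creation operator on the vacuum -/

namespace Prof

variable {A B C D : Type u} [SmallCategory A] [SmallCategory B] [SmallCategory C] [SmallCategory D]

/-- A morphism `F a ⟶ b` as an element of the profunctor of `F`. -/
def repMk (F : A ⥤ B) {a : A} {b : B} (f : F.obj a ⟶ b) : (rep F).obj (op a, b) := f

theorem rep_ind {F : A ⥤ B} {a : A} {b : B} (t : (rep F).obj (op a, b)) : ∃ f, t = repMk F f :=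
  ⟨t, rfl⟩

theorem repMk_post (F : A ⥤ B) {a : A} {b b' : B} (f : F.obj a ⟶ b) (g : b ⟶ b') :
    (rep F).post g (repMk F f) = repMk F (f ≫ g) := by
  change F.map (𝟙 a) ≫ f ≫ g = f ≫ g
  simp

theorem repMk_pre (F : A ⥤ B) {a a' : A} {b : B} (g : a' ⟶ a) (f : F.obj a ⟶ b) :
    (rep F).pre g (repMk F f) = repMk F (F.map g ≫ f) := by
  change F.map g ≫ f ≫ 𝟙 b = F.map g ≫ f
  simp

/-- A morphism `b ⟶ F a` as an element of the opposite profunctor of `F`. -/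
def corepMk (F : A ⥤ B) {a : A} {b : B} (f : b ⟶ F.obj a) : (corep F).obj (op b, a) := f

theorem corep_ind {F : A ⥤ B} {a : A} {b : B} (t : (corep F).obj (op b, a)) :
    ∃ f, t = corepMk F f :=
  ⟨t, rfl⟩

theorem corepMk_post (F : A ⥤ B) {a a' : A} {b : B} (f : b ⟶ F.obj a) (g : a ⟶ a') :
    (corep F).post g (corepMk F f) = corepMk F (f ≫ F.map g) := by
  change 𝟙 b ≫ f ≫ F.map g = f ≫ F.map g
  simp

theorem corepMk_pre (F : A ⥤ B) {a : A} {b b' : B} (g : b' ⟶ b) (f : b ⟶ F.obj a) :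
    (corep F).pre g (corepMk F f) = corepMk F (g ≫ f) := by
  change g ≫ f ≫ F.map (𝟙 a) = g ≫ f
  simp

/-- The exponential with respect to the free algebra, with `δ` and `μ` unfolded. -/
abbrev expFree (T : Prof (Fock A) (Fock B)) : Prof (Fock A) (Fock B) :=
  ((corep Fock.flatten).comp T.bang).comp (rep Fock.flatten)

/-- The class of an element of `exp_μ T = μ ∘ !T ∘ δ`. -/
def expMk {T : Prof (Fock A) (Fock B)} {x : Fock A} {y : Fock B}
    (z : Fock ((Fock A)ᵒᵖ × Fock B)) (t : ∀ i, T.obj (z.get i))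
    (d : x ⟶ Fock.flatten.obj (srcs z)) (m : Fock.flatten.obj (tgts z) ⟶ y) :
    (expFree T).obj (op x, y) :=
  compMk (tgts z) (compMk (srcs z) (corepMk Fock.flatten d) (bangMk z t (𝟙 _) (𝟙 _)))
    (repMk Fock.flatten m)

/-- The two legs of an element of `!T` slide across the composites with δ and μ and are absorbed by
`d` and `m`. This eliminates the coends over α and β; only the one over z remains. -/
theorem compMk_bangMk {T : Prof (Fock A) (Fock B)} {x : Fock A} {y : Fock B}
    {α : Fock (Fock A)} {β : Fock (Fock B)} (z : Fock ((Fock A)ᵒᵖ × Fock B))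
    (t : ∀ i, T.obj (z.get i)) (k : α ⟶ srcs z) (l : tgts z ⟶ β)
    (d : x ⟶ Fock.flatten.obj α) (m : Fock.flatten.obj β ⟶ y) :
    (compMk β (compMk α (corepMk Fock.flatten d) (bangMk z t k l)) (repMk Fock.flatten m) :
        (expFree T).obj (op x, y)) =
      expMk z t (d ≫ Fock.flatten.map k) (Fock.flatten.map l ≫ m) := by
  have h₁ : (bangMk z t k l : T.bang.obj (op α, β)) =
      T.bang.pre k (T.bang.post l (bangMk z t (𝟙 _) (𝟙 _))) := by
    rw [bang_post, bang_pre, Category.comp_id, Category.id_comp]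
  rw [h₁, ← compMk_sound, ← comp_post, compMk_sound, corepMk_post, repMk_pre]
  rfl

theorem exp_ind {T : Prof (Fock A) (Fock B)} {x : Fock A} {y : Fock B}
    (e : (expFree T).obj (op x, y)) : ∃ z t d m, e = expMk (T := T) z t d m := by
  obtain ⟨β, s, m, rfl⟩ := comp_ind e
  obtain ⟨α, d, b, rfl⟩ := comp_ind s
  obtain ⟨z, t, k, l, rfl⟩ := bang_ind b
  obtain ⟨d, hd⟩ := corep_ind d
  obtain ⟨m, hm⟩ := rep_ind m
  rw [hd, hm]
  exact ⟨_, _, _, _, compMk_bangMk z t k l d m⟩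

theorem expMk_sound {T : Prof (Fock A) (Fock B)} {x : Fock A} {y : Fock B}
    {z w : Fock ((Fock A)ᵒᵖ × Fock B)} (g : z ⟶ w) (t : ∀ i, T.obj (z.get i))
    (s : ∀ i, T.obj (w.get i)) (h : ∀ i, T.map (g.app i) (t i) = s (g.perm i))
    (d : x ⟶ Fock.flatten.obj (srcs w)) (m : Fock.flatten.obj (tgts w) ⟶ y) :
    (expMk w s d m : (expFree T).obj (op x, y)) =
      expMk z t (d ≫ Fock.flatten.map (srcsMap g)) (Fock.flatten.map (tgtsMap g) ≫ m) := by
  have hs : (Fock.piFunctor T).map g t = s := (Fock.piFunctor_map_eq_iff T g t s).2 h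
  subst hs
  unfold expMk
  rw [bangMk_sound, compMk_bangMk, Category.id_comp, Category.comp_id]
  rfl

/-- The adjoining functor `(a, x) ↦ x · (a)`. -/
abbrev adjoin (A : Type u) [SmallCategory A] : A × Fock A ⥤ Fock A :=
  Functor.prod' (CategoryTheory.Prod.snd A (Fock A))
    (CategoryTheory.Prod.fst A (Fock A) ⋙ Fock.single) ⋙ Fock.concat

/-- The unit functor `x ↦ (*, x)`. -/
abbrev unitor (A : Type u) [SmallCategory A] : A ⥤ One.{u} × A :=
  Functor.prod' ((Functor.const _).obj (Discrete.mk PUnit.unit)) (𝟭 A)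

/-- The creation operator of a presheaf, with its ingredients unfolded. -/
abbrev creationFree (V : A ⥤ Type u) : Prof (Fock A) (Fock A) :=
  (rep (unitor (Fock A))).comp
    (((ofPresheaf V).tensor (Prof.id (Fock A))).comp (rep (adjoin A)))

/-- An element of `V × I`. -/
def vectorMk {V : A ⥤ Type u} {o : One.{u}} {a : A} {x x' : B} (v : V.obj a) (f : x ⟶ x') :
    ((ofPresheaf V).tensor (Prof.id B)).obj (op (o, x), (a, x')) := (v, f)

theorem vector_ind {V : A ⥤ Type u} {o : One.{u}} {a : A} {x x' : B}
    (t : ((ofPresheaf V).tensor (Prof.id B)).obj (op (o, x), (a, x'))) :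
    ∃ v f, t = vectorMk v f :=
  ⟨t.1, t.2, rfl⟩

theorem vectorMk_post {V : A ⥤ Type u} {o : One.{u}} {a a' : A} {x x' x'' : B} (v : V.obj a)
    (f : x ⟶ x') (g : a ⟶ a') (h : x' ⟶ x'') :
    ((ofPresheaf V).tensor (Prof.id B)).post (Prod.mkHom g h : (a, x') ⟶ (a', x''))
      (vectorMk (o := o) v f) = vectorMk (V.map g v) (f ≫ h) :=
  Prod.ext rfl (Category.id_comp (f ≫ h))

theorem vectorMk_pre {V : A ⥤ Type u} {o : One.{u}} {a : A} {x x' x'' : B} (v : V.obj a)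
    (f : x ⟶ x') (g : x'' ⟶ x) :
    ((ofPresheaf V).tensor (Prof.id B)).pre (Prod.mkHom (𝟙 o) g : (o, x'') ⟶ (o, x))
      (vectorMk v f) = vectorMk v (g ≫ f) := by
  refine Prod.ext ?_ ?_
  · exact V.map_id_apply a v
  change g ≫ f ≫ 𝟙 x' = g ≫ f
  rw [Category.comp_id]

/-- The creation operator of `V` acts on `x ↦ ∏ i, V (x i)`. -/
def creationAct (V : A ⥤ Type u) :
    Act (creationFree V) (Fock.piFunctor V) (Fock.piFunctor V) :=
  (Act.rep (unitor (Fock A)) (P := Fock.piFunctor V)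
    (Q := FunctorToTypes.prod
      (CategoryTheory.Prod.fst One.{u} (Fock A) ⋙ (Functor.const One.{u}).obj PUnit)
      (CategoryTheory.Prod.snd One.{u} (Fock A) ⋙ Fock.piFunctor V))
    { app := fun _ => ↾fun p => (PUnit.unit, p)
      naturality := fun _ _ _ => rfl }).comp
    (((Act.ofPresheaf V).tensor (Act.id (Fock.piFunctor V))).comp (Act.rep _ (adjoinPi V)))

/-- The point of `∏ i, V (x i)` for the empty tuple `x`. -/
def vacuumAct (V : A ⥤ Type u) :
    Act (rep ((Functor.const One.{u}).obj Fock.nil)) ((Functor.const One.{u}).obj PUnit)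
      (Fock.piFunctor V) :=
  Act.rep _
    { app := fun _ => ↾fun _ i => Fin.elim0 i
      naturality := fun _ _ _ => ConcreteCategory.hom_ext _ _ fun _ => funext fun i =>
        Fin.elim0 i }

/-- The exponential of the creation operator of `V` acts on `x ↦ ∏ i, V (x i)`. -/
def expAct (V : A ⥤ Type u) :
    Act (expFree (creationFree V)) (Fock.piFunctor V) (Fock.piFunctor V) :=
  ((Act.corep Fock.flatten (Fock.flattenPi V).inv).comp (creationAct V).bang).comp
    (Act.rep Fock.flatten (Fock.flattenPi V).hom)

theorem Act.comp_act {S : Prof A B} {T : Prof B C} {P : A ⥤ Type u} {Q : B ⥤ Type u}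
    {R : C ⥤ Type u} (F : Act S P Q) (G : Act T Q R) {a : A} {b : B} {c : C}
    (s : S.obj (op a, b)) (t : T.obj (op b, c)) (p : P.obj a) :
    (F.comp G).act (compMk b s t) p = G.act t (F.act s p) := rfl

theorem Act.rep_act (F : A ⥤ B) {P : A ⥤ Type u} {Q : B ⥤ Type u} (θ : P ⟶ F ⋙ Q) {a : A} {b : B}
    (f : F.obj a ⟶ b) (p : P.obj a) :
    (Act.rep F θ).act (repMk F f) p = Q.map f (θ.app a p) := rfl

theorem Act.vector_act {V : A ⥤ Type u} {P : B ⥤ Type u} {o : One.{u}} {a : A} {x x' : B}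
    (v : V.obj a) (f : x ⟶ x') (q : PUnit) (p : P.obj x) :
    ((Act.ofPresheaf V).tensor (Act.id P)).act (vectorMk (o := o) v f) (q, p) =
      (v, P.map f p) := rfl

theorem Act.bang_act {T : Prof A B} {P : A ⥤ Type u} {Q : B ⥤ Type u} (F : Act T P Q)
    {x : Fock A} {y : Fock B} (z : Fock (Aᵒᵖ × B)) (t : ∀ i, T.obj (z.get i)) (k : x ⟶ srcs z)
    (l : tgts z ⟶ y) (p : (Fock.piFunctor P).obj x) :
    F.bang.act (bangMk z t k l) p = (Fock.piFunctor Q).map l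
      (fun i => F.act (a := (z.get i).1.unop) (t i) ((Fock.piFunctor P).map k p i)) := rfl

/-- The element of `η^{†,V}((), (a))` given by an element of `V a`. -/
def creationMk {V : A ⥤ Type u} {a : A} (v : V.obj a) :
    (creationFree V).obj (op Fock.nil, Fock.single.obj a) :=
  compMk ((⟨PUnit.unit⟩, Fock.nil) : One.{u} × Fock A) (repMk (unitor (Fock A)) (𝟙 _))
    (compMk ((a, Fock.nil) : A × Fock A) (vectorMk v (𝟙 Fock.nil))
      (repMk (adjoin A) (Fock.nilConcat a)))

theorem creationMk_map {V : A ⥤ Type u} {a b : A} (g : a ⟶ b) (v : V.obj a) :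
    (creationFree V).post (Fock.single.map g) (creationMk v) = creationMk (V.map g v) := by
  unfold creationMk
  rw [comp_post, comp_post, repMk_post]
  have h : (repMk (adjoin A) (Fock.nilConcat a ≫ Fock.single.map g) :
      (rep (adjoin A)).obj (op (a, Fock.nil), _)) =
      (rep (adjoin A)).pre (Prod.mkHom g (𝟙 Fock.nil) : (a, Fock.nil) ⟶ (b, Fock.nil))
        (repMk (adjoin A) (Fock.nilConcat b)) := by
    rw [repMk_pre]
    exact congrArg (repMk (adjoin A)) (Fock.nilConcat_naturality g).symm
  rw [h, ← compMk_sound, vectorMk_post, Category.comp_id]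

/-- Co-Yoneda for the representable factors: all morphisms slide into the last one, leaving a vector
and a morphism out of () · (a) ≅ (a). -/
theorem creation_ind {V : A ⥤ Type u} {y : Fock A} (t : (creationFree V).obj (op Fock.nil, y)) :
    ∃ (a : A) (v : V.obj a) (g : Fock.single.obj a ⟶ y),
      t = (creationFree V).post g (creationMk v) := by
  obtain ⟨⟨⟨⟨⟩⟩, x⟩, r, s, rfl⟩ := comp_ind t
  obtain ⟨⟨a, x'⟩, w, f, rfl⟩ := comp_ind s
  obtain ⟨v, h, rfl⟩ := vector_ind w
  obtain ⟨r, hr⟩ := rep_ind r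
  obtain ⟨f, hf⟩ := rep_ind f
  rw [hr, hf]
  -- The composite (a) ≅ () · (a) → x' · (a) → y.
  refine ⟨a, v, inv (Fock.nilConcat a) ≫ (adjoin A).map (Prod.mkHom (𝟙 a) (r.2 ≫ h)) ≫ f, ?_⟩
  unfold creationMk
  rw [comp_post, comp_post, repMk_post, IsIso.hom_inv_id_assoc, ← repMk_pre, ← compMk_sound,
    vectorMk_post, Category.id_comp, V.map_id_apply, ← vectorMk_pre, ← comp_pre, ← compMk_sound,
    repMk_post]
  refine congrArg (fun r => compMk _ (repMk _ r) _) ?_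
  exact (Category.id_comp _).symm

/-- The tuple of the pairs `((), β i)`. -/
abbrev nilTuple (A : Type u) [SmallCategory A] (β : Fock B) : Fock ((Fock A)ᵒᵖ × B) :=
  ⟨β.len, fun i => (op Fock.nil, β.get i)⟩

/-- The action of `nilTuple` on morphisms. -/
def nilTupleMap (A : Type u) [SmallCategory A] {β γ : Fock B} (f : β ⟶ γ) :
    nilTuple A β ⟶ nilTuple A γ :=
  ⟨f.perm, fun i => Prod.mkHom (𝟙 _) (f.app i)⟩

theorem flatten_nilTuple_len {A B : Type u} [SmallCategory A] (β : Fock B) : (Fock.flatten.obj (srcs (nilTuple A β))).len = 0 :=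
  (Fock.flatten_len_eq_zero_iff _).2 fun _ => rfl

/-- The class of an element of `(exp_μ T)((), y)`. -/
def expNilMk {T : Prof (Fock A) (Fock B)} {y : Fock B} (β : Fock (Fock B))
    (t : ∀ i, T.obj (op Fock.nil, β.get i)) (m : Fock.flatten.obj β ⟶ y) :
    (expFree T).obj (op Fock.nil, y) :=
  expMk (nilTuple A β) t (Fock.nilHom (flatten_nilTuple_len β)) m

theorem expNilMk_sound {T : Prof (Fock A) (Fock B)} {y : Fock B} {β γ : Fock (Fock B)} (f : β ⟶ γ)
    (t : ∀ i, T.obj (op Fock.nil, β.get i)) (s : ∀ i, T.obj (op Fock.nil, γ.get i))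
    (h : ∀ i, T.post (f.app i) (t i) = s (f.perm i)) (m : Fock.flatten.obj γ ⟶ y) :
    expNilMk γ s m = expNilMk β t (Fock.flatten.map f ≫ m) := by
  unfold expNilMk
  rw [expMk_sound (nilTupleMap A f) t s h]
  exact congrArg₂ (expMk (T := T) (nilTuple A β) t) (Fock.nil_hom_eq _ _) rfl

theorem expNil_ind {T : Prof (Fock A) (Fock B)} {y : Fock B}
    (e : (expFree T).obj (op Fock.nil, y)) : ∃ β t m, e = expNilMk (T := T) β t m := by
  obtain ⟨z, t, d, m, rfl⟩ := exp_ind e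
  -- `d` preserves length, so the sources concatenate to an empty tuple and each of them is empty.
  have hz : ∀ i, (z.get i).1.unop.len = 0 :=
    (Fock.flatten_len_eq_zero_iff (srcs z)).1 (Fock.len_eq d).symm
  refine ⟨tgts z, fun i => T.map (Prod.mkHom (Fock.nilHom (hz i)).op (𝟙 (z.get i).2)) (t i),
    m, ?_⟩
  unfold expNilMk
  -- The change of tuple replaces each source by () and fixes the targets.
  rw [expMk_sound (z := z) (w := nilTuple A (tgts z))
    ⟨Equiv.refl _, fun i => Prod.mkHom (Fock.nilHom (hz i)).op (𝟙 (z.get i).2)⟩ t _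
    (fun _ => rfl)]
  refine congrArg₂ (expMk z t) (Fock.nil_hom_eq _ _) ?_
  exact ((congrArg (· ≫ m) (Fock.flatten.map_id (tgts z))).trans (Category.id_comp m)).symm

/-- The element of `exp_μ(η^{†,V})((), y)` given by elements of the `V (y i)`. -/
def creationPi {V : A ⥤ Type u} {y : Fock A} (p : ∀ i, V.obj (y.get i)) :
    (expFree (creationFree V)).obj (op Fock.nil, y) :=
  expNilMk ((Fock.mapFunctor Fock.single).obj y) (fun i => creationMk (p i))
    (Fock.flattenSingle y)

/-- Each factor is a vector pushed along some (a_i) → β_i. These morphisms move into `m`, leaving a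
tuple of one-entry tuples. What remains of `m` is then a morphism (a_1, …, a_n) → y, which acts on
the vectors. -/
theorem creationPi_surjective {V : A ⥤ Type u} {y : Fock A}
    (e : (expFree (creationFree V)).obj (op Fock.nil, y)) :
    ∃ p, e = creationPi (V := V) p := by
  obtain ⟨β, t, m, rfl⟩ := expNil_ind e
  choose a v f hf using fun i => creation_ind (t i)
  have h := expNilMk_sound (T := creationFree V) (β := (Fock.mapFunctor Fock.single).obj ⟨β.len, a⟩)
    (γ := β) ⟨Equiv.refl _, f⟩ (fun i => creationMk (v i)) t (fun i => (hf i).symm) m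
  rw [h]
  generalize Fock.flatten.map _ ≫ m = m'
  -- Possible because `flattenSingle` is invertible; by its naturality `r` can be moved back onto
  -- the factors.
  obtain ⟨r, rfl⟩ : ∃ r : (⟨β.len, a⟩ : Fock A) ⟶ y, m' = Fock.flattenSingle _ ≫ r :=
    ⟨inv (Fock.flattenSingle _) ≫ m', (IsIso.hom_inv_id_assoc _ _).symm⟩
  refine ⟨(Fock.piFunctor V).map r v, ?_⟩
  rw [← Fock.flattenSingle_naturality]
  refine (expNilMk_sound _ _ _ (fun i => ?_) _).symm
  refine (creationMk_map (r.app i) (v i)).trans (congrArg creationMk ?_)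
  exact (Fock.piFunctor_map_perm V r v i).symm

theorem creationAct_creationMk {V : A ⥤ Type u} {a : A} (v : V.obj a)
    (q : (Fock.piFunctor V).obj Fock.nil) :
    (creationAct V).act (creationMk v) q = fun _ => v := by
  unfold creationMk creationAct
  rw [Act.comp_act, Act.comp_act, Act.rep_act, Act.rep_act, Functor.map_id_apply]
  refine (congrArg (fun w => (Fock.piFunctor V).map (Fock.nilConcat a)
    ((adjoinPi V).app (a, Fock.nil) w)) (Act.vector_act v (𝟙 Fock.nil) PUnit.unit q)).trans ?_
  exact Fock.piFunctor_map_nilConcat V (fun s => Sum.rec (motive := fun s => V.obj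
    (Sum.elim Fock.nil.get (fun _ : Fin 1 => a) s)) ((Fock.piFunctor V).map (𝟙 Fock.nil) q)
      (fun _ => v) s)

/-- Each block creates its own vector p_i from the empty product, and reassembling one-entry blocks
gives p. Hence distinct p give distinct canonical elements. -/
theorem expAct_creationPi {V : A ⥤ Type u} {y : Fock A} (p : ∀ i, V.obj (y.get i))
    (q : (Fock.piFunctor V).obj Fock.nil) : (expAct V).act (creationPi p) q = p := by
  unfold creationPi expNilMk expMk expAct
  rw [Act.comp_act, Act.comp_act, Act.rep_act]
  refine (congrArg (fun w => (Fock.piFunctor V).map (Fock.flattenSingle y)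
    ((Fock.flattenPi V).hom.app _ w)) ((Act.bang_act (creationAct V) _ _ _ _ _).trans
      ((Functor.map_id_apply _ _ _).trans
        (funext fun i => creationAct_creationMk (p i) _)))).trans ?_
  exact Fock.piFunctor_map_flattenSingle V p

theorem vacuum_exp_iso (V : A ⥤ Type u) :
    Nonempty ((vacuum A).comp (exp (mu A) (creationOf (ofPresheaf V))) ≅
      ofPresheaf (Fock.piFunctor V)) := by
  change Nonempty ((rep ((Functor.const One.{u}).obj Fock.nil)).comp
    (expFree (creationFree V)) ≅ _)
  refine ((vacuumAct V).comp (expAct V)).nonempty_iso_of_bijective fun y => ?_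
  let s (p : (Fock.piFunctor V).obj y) : ((rep ((Functor.const One.{u}).obj Fock.nil)).comp
      (expFree (creationFree V))).obj (op (Discrete.mk PUnit.unit), y) :=
    compMk Fock.nil (repMk ((Functor.const One.{u}).obj Fock.nil) (𝟙 Fock.nil)) (creationPi p)
  refine Function.bijective_iff_has_inverse.2 ⟨s, fun e => ?_, fun p => ?_⟩
  · have hs : ∃ p, e = s p := by
      obtain ⟨x, v, w, rfl⟩ := comp_ind (S := rep ((Functor.const One.{u}).obj Fock.nil))
        (T := expFree (creationFree V)) e
      obtain ⟨v, hv⟩ := rep_ind v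
      rw [hv]
      -- The vacuum is represented by (), so `v : () → x` is absorbed into `w` before normalising.
      obtain ⟨p, hp⟩ := creationPi_surjective ((expFree (creationFree V)).pre v w)
      refine ⟨p, ?_⟩
      change _ = compMk _ _ _
      rw [← hp, ← compMk_sound, repMk_post]
      exact congrArg (fun v => compMk x (repMk _ v) w) (Category.id_comp v).symm
    obtain ⟨p, rfl⟩ := hs
    -- Since `s` is surjective, its being a section of evaluation already makes it a two-sided
    -- inverse.
    exact congrArg s (expAct_creationPi p _)
  · exact expAct_creationPi p _

end Prof

/-! ### Tuples over the empty category -/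

namespace Fock

variable {A B : Type u} [SmallCategory A] [SmallCategory B]

theorem len_zero (x : Fock Zero.{u}) : x.len = 0 := by
  by_contra h
  exact (x.get ⟨0, Nat.pos_of_ne_zero h⟩).as.elim

instance (x y : Fock Zero.{u}) : Subsingleton (x ⟶ y) :=
  ⟨fun _ _ => hom_ext (fun i => (x.get i).as.elim) (fun i => (x.get i).as.elim)⟩

/-- The morphism between tuples without entries. -/
def zeroHom (x y : Fock Zero.{u}) : x ⟶ y :=
  ⟨finCongr (x.len_zero.trans y.len_zero.symm), fun i => (x.get i).as.elim⟩

theorem hom_ext_of_subsingleton [∀ a b : A, Subsingleton (a ⟶ b)] {x y : Fock A} {f g : x ⟶ y}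
    (h : ∀ i, f.perm i = g.perm i) : f = g :=
  hom_ext h fun _ => Subsingleton.elim _ _

end Fock

/-! ### The coherent state extension -/

namespace Prof

variable {A B C D : Type u} [SmallCategory A] [SmallCategory B] [SmallCategory C] [SmallCategory D]

/-- The tuple of the pairs `(a, x i)`. -/
abbrev constTuple (a : A) (x : Fock B) : Fock (Aᵒᵖ × B) := ⟨x.len, fun i => (op a, x.get i)⟩

/-- The tuple with constant entries `a` and the length of `x`. -/
abbrev constLike (a : A) (x : Fock B) : Fock A := ⟨x.len, fun _ => a⟩

/-- The hypotheses make every object of A uniquely isomorphic to `a`, so all sources can be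
relabelled `a` while the right leg is absorbed into the targets. It is used for A = 1 and for A =
!0. -/
theorem bang_constTuple_ind {T : Prof A B} [∀ a b : A, Subsingleton (a ⟶ b)] (a : A)
    (φ : ∀ b : A, a ⟶ b) (ψ : ∀ b : A, b ⟶ a)
    {x : Fock A} {y : Fock B} (e : T.bang.obj (op x, y)) :
    ∃ (p : ∀ i, T.obj (op a, y.get i)) (k : x ⟶ constLike a y),
      e = T.bang.pre k (bangMk (constTuple a y) p (𝟙 _) (𝟙 _)) := by
  obtain ⟨z, t, k, l, rfl⟩ := bang_ind e
  let g : z ⟶ constTuple a y := ⟨l.perm, fun i => Prod.mkHom (φ (z.get i).1.unop).op (l.app i)⟩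
  let k' : x ⟶ constLike a y := ⟨k.perm.trans l.perm, fun i => ψ (x.get i)⟩
  obtain ⟨s, hs⟩ : ∃ s : ∀ i, T.obj (op a, y.get i), s = (Fock.piFunctor T).map g t := ⟨_, rfl⟩
  refine ⟨s, k', ?_⟩
  rw [bang_pre, hs]
  refine Eq.trans ?_ (bangMk_sound g t _ _).symm
  refine congrArg₂ (bangMk z t) ?_ (Category.comp_id l).symm
  -- As A is thin, the left legs need only agree on permutations.
  refine Fock.hom_ext_of_subsingleton fun i => ?_
  change k.perm i = l.perm.symm (l.perm (k.perm i))
  simp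

/-- The canonical element of `ext V`. -/
def extMk {V : A ⥤ Type u} {y : Fock A} (p : ∀ i, V.obj (y.get i)) :
    (phi.comp ((corep Fock.flatten).comp (phiInv.bang.comp (ofPresheaf V).bang))).obj
      (op (Discrete.mk PUnit.unit), y) :=
  compMk (S := phi) Fock.nil PUnit.unit
    (compMk _ (corepMk Fock.flatten (Fock.zeroHom _ _))
      (compMk (constLike (Discrete.mk PUnit.unit) y)
        (bangMk (constTuple Fock.nil (constLike (Discrete.mk PUnit.unit) y))
          (fun _ => PUnit.unit) (𝟙 _) (𝟙 _))
        (bangMk (T := ofPresheaf V) (constTuple (Discrete.mk PUnit.unit) y) p (𝟙 _) (𝟙 _))))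

/-- The coends are contracted from the target end: normalise `!V`, pass its left leg to `!phiInv`,
normalise that, pass its leg to δ, and finally pass the unique morphism of !0 to `phi`, whose values
are singletons. -/
theorem extMk_surjective {V : A ⥤ Type u} {y : Fock A}
    (e : (phi.comp ((corep Fock.flatten).comp (phiInv.bang.comp (ofPresheaf V).bang))).obj
      (op (Discrete.mk PUnit.unit), y)) : ∃ p, e = extMk (V := V) p := by
  obtain ⟨x, u, e, rfl⟩ := comp_ind e
  obtain ⟨α, h, e, rfl⟩ := comp_ind e
  obtain ⟨β, w, e, rfl⟩ := comp_ind e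
  obtain ⟨p, k, rfl⟩ := bang_constTuple_ind (Discrete.mk PUnit.unit)
    (fun _ => 𝟙 _) (fun _ => 𝟙 _) e
  rw [← compMk_sound]
  obtain ⟨q, k', hw⟩ := bang_constTuple_ind (T := phiInv) Fock.nil
    (fun _ => Fock.zeroHom _ _) (fun _ => Fock.zeroHom _ _) (phiInv.bang.post k w)
  rw [hw, ← comp_pre, ← compMk_sound]
  obtain ⟨h', hh⟩ := corep_ind ((corep Fock.flatten).post k' h)
  -- Uniqueness of morphisms in !0 lets `h'` factor through (), so that x can be replaced by ().
  rw [hh, Subsingleton.elim h' (Fock.zeroHom x Fock.nil ≫ Fock.zeroHom _ _), ← corepMk_pre,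
    ← comp_pre, ← compMk_sound]
  exact ⟨p, rfl⟩

theorem ext_iso (V : A ⥤ Type u) :
    Nonempty (ext (ofPresheaf V) ≅ ofPresheaf (Fock.piFunctor V)) := by
  refine (extAct V).nonempty_iso_of_bijective fun y => ?_
  have h (p : ∀ i, V.obj (y.get i)) : (extAct V).act (extMk p) PUnit.unit = p :=
    (Fock.piFunctor V).map_id_apply y p
  refine Function.bijective_iff_has_inverse.2 ⟨extMk, fun e => ?_, h⟩
  obtain ⟨p, rfl⟩ := extMk_surjective e
  exact congrArg extMk (h p)

end Prof

/-- Co-Yoneda: a pair (p, f) is identified with (f_* p, 𝟙), and evaluation sends it to f_* p. -/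
theorem ketExpansion_iso {A : Type u} [SmallCategory A] (V : A ⥤ Type u) :
    Nonempty (ketExpansion V ≅ Fock.piFunctor V) := by
  let ev (y : Fock A) (e : (ketExpansion V).obj y) : (Fock.piFunctor V).obj y :=
    coendLift (P := Fock.piFunctor V) (Q := yoneda.obj y)
      (fun _ p f => (Fock.piFunctor V).map f p)
      (fun g p f => ((Fock.piFunctor V).map_comp_apply g f p).symm) e
  let mk (y : Fock A) (p : (Fock.piFunctor V).obj y) : (ketExpansion V).obj y :=
    coendMk (P := Fock.piFunctor V) (Q := yoneda.obj y) y p (𝟙 y)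
  have ind (y : Fock A) (e : (ketExpansion V).obj y) : ∃ x p f,
      e = coendMk (P := Fock.piFunctor V) (Q := yoneda.obj y) x p f := coend_ind e
  have h (y : Fock A) (p : (Fock.piFunctor V).obj y) : ev y (mk y p) = p :=
    (Fock.piFunctor V).map_id_apply y p
  refine ⟨NatIso.ofComponents (fun y => Equiv.toIso ⟨ev y, mk y, fun e => ?_, h y⟩) ?_⟩
  · obtain ⟨x, p, f, rfl⟩ := ind y e
    refine (coendMk_sound (P := Fock.piFunctor V) (Q := yoneda.obj y) f p (𝟙 y)).trans ?_
    exact congrArg (coendMk x p) (Category.comp_id f)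
  · intro y y' g
    refine ConcreteCategory.hom_ext _ _ fun e => ?_
    obtain ⟨x, p, f, rfl⟩ := ind y e
    exact (Fock.piFunctor V).map_comp_apply f g p

end FockSpace

theorem mainTheorem3 {A : Type u} [SmallCategory A] (V : A ⥤ Type u) :
    Nonempty ((FockSpace.Prof.vacuum A).comp
        (FockSpace.Prof.exp (FockSpace.Prof.mu A)
          (FockSpace.Prof.creationOf (FockSpace.Prof.ofPresheaf V))) ≅
      FockSpace.Prof.ext (FockSpace.Prof.ofPresheaf V)) ∧
    Nonempty ((FockSpace.Prof.ext (FockSpace.Prof.ofPresheaf V)).toPresheaf ≅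
      FockSpace.ketExpansion V) := by
  obtain ⟨e₁⟩ := FockSpace.Prof.vacuum_exp_iso V
  obtain ⟨e₂⟩ := FockSpace.Prof.ext_iso V
  obtain ⟨e₃⟩ := FockSpace.ketExpansion_iso V
  exact ⟨⟨e₁ ≪≫ e₂.symm⟩, ⟨(Functor.curry.mapIso e₂).app (op (Discrete.mk PUnit.unit)) ≪≫
    NatIso.ofComponents (fun _ => Iso.refl _) (fun _ => rfl) ≪≫ e₃.symm⟩⟩
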